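/- Let $(Y,d)$ be a metric space and let $R=(Y,\tau_j,q_j)_{0\le j\le n-1}$ be an iterated function system with weights: each $\tau_j:Y\to Y$ is a contraction (it has a Lipschitz constant $<1$) and each $q_j:Y\to(0,\infty)$ is a continuous function satisfying the Dini condition $$\int_0^1 \sup_{d(x,y)\le t}\frac{|\ln q_j(x)-\ln q_j(y)|}{t}\,dt<+\infty .$$ Let $K\subseteq Y$ be the attractor, that is, a nonempty compact set with $\bigcup_{j=0}^{n-1}\tau_j(K)=K$. For a continuous function $f$ put $B_R(f)(x)=\sum_{j=0}^{n-1}q_j(x)f(\tau_j x)$, and let $\rho$ be the spectral radius of $B_R$ acting on the Banach space $C(K)$. Let $\mu$ be a Borel probability measure on $K$ with $B_R^*\mu=\rho\,\mu$, that is, $\int_K B_R(f)\,d\mu=\rho\int_K f\,d\mu$ for every $f\in C(K)$. Then for every point $x_0\in Y$ and every continuous $f:Y\to\mathbb R$, $$\lim_{k\to\infty}\frac{B_R^{k}(f)(x_0)}{B_R^{k}(1)(x_0)}=\int_K f\,d\mu .$$ -/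

import Mathlib

open MeasureTheory Filter Topology

/-- An iterated function system with weights `(Y, τ_j, q_j)`, `0 ≤ j ≤ n - 1`: finitely many
continuous self-maps `τ_j` of `Y` together with positive continuous weights `q_j`, which need not
sum to one. -/
structure IFSw (n : ℕ) (Y : Type*) [TopologicalSpace Y] where
  /-- the maps `τ_j` -/
  map : Fin n → C(Y, Y)
  /-- the weights `q_j` -/
  weight : Fin n → C(Y, ℝ)
  weight_pos : ∀ j x, 0 < weight j x

namespace IFSw

variable {n : ℕ}

/-- The transfer (Hutchinson–Barnsley) operator `B_R(f)(x) = ∑ j, q_j(x) f(τ_j x)` on continuous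
functions. -/
noncomputable def transfer (𝕜 : Type*) [RCLike 𝕜] {Y : Type*} [TopologicalSpace Y]
    (R : IFSw n Y) : C(Y, 𝕜) →ₗ[𝕜] C(Y, 𝕜) where
  toFun f := ⟨fun x => ∑ j, ((R.weight j x : ℝ) : 𝕜) * f (R.map j x), by fun_prop⟩
  map_add' f g := by
    ext x
    simp [mul_add, Finset.sum_add_distrib]
  map_smul' c f := by
    ext x
    simp [Finset.mul_sum, mul_left_comm]

/-- The transfer operator as a bounded operator on the Banach space `C(Y, 𝕜)` with the sup norm,
`Y` compact. -/
noncomputable def transferCLM (𝕜 : Type*) [RCLike 𝕜] {Y : Type*} [TopologicalSpace Y]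
    [CompactSpace Y] (R : IFSw n Y) : C(Y, 𝕜) →L[𝕜] C(Y, 𝕜) where
  toLinearMap := R.transfer 𝕜
  cont := by
    have h : (fun f : C(Y, 𝕜) => R.transfer 𝕜 f) = fun f => ∑ j,
        (⟨fun x => ((R.weight j x : ℝ) : 𝕜), by fun_prop⟩ : C(Y, 𝕜)) * f.comp (R.map j) := by
      funext f
      ext x
      simp [transfer]
    change Continuous fun f : C(Y, 𝕜) => R.transfer 𝕜 f
    rw [h]
    exact continuous_finsetSum _ fun j _ =>
      continuous_const.mul (ContinuousMap.continuous_precomp (R.map j))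

/-- The nonempty compact set `K` is the attractor of the maps: `⋃ j, τ_j(K) = K`.
(For contractions there is at most one such set.) -/
def IsAttractor {Y : Type*} [TopologicalSpace Y] (R : IFSw n Y)
    (K : TopologicalSpace.NonemptyCompacts Y) : Prop :=
  ⋃ j, R.map j '' (K : Set Y) = K

theorem IsAttractor.mapsTo {Y : Type*} [TopologicalSpace Y] {R : IFSw n Y}
    {K : TopologicalSpace.NonemptyCompacts Y} (h : R.IsAttractor K) (j : Fin n) :
    Set.MapsTo (R.map j) (K : Set Y) (K : Set Y) := fun x hx => by
  rw [← h]
  exact Set.mem_iUnion.2 ⟨j, x, hx, rfl⟩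

/-- The restriction of an IFSw to its attractor. -/
def onAttractor {Y : Type*} [TopologicalSpace Y] (R : IFSw n Y)
    {K : TopologicalSpace.NonemptyCompacts Y} (hK : R.IsAttractor K) : IFSw n K where
  map j := ⟨fun x => ⟨R.map j x, hK.mapsTo j x.2⟩, by fun_prop⟩
  weight j := ⟨fun x => R.weight j x, by fun_prop⟩
  weight_pos j x := R.weight_pos j x

/-- The spectral radius `ρ` of the transfer operator acting on the complex Banach space
`C(Y, ℂ)`, `Y` compact. -/
noncomputable def specRadius {Y : Type*} [TopologicalSpace Y] [CompactSpace Y]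
    (R : IFSw n Y) : ℝ :=
  (spectralRadius ℂ (R.transferCLM ℂ)).toReal

/-- `B_R^* μ = c μ`, where `B_R^*` is the dual of the transfer operator acting on the finite Borel
measures of the compact space `Y`: `∫ B_R(f) dμ = c ∫ f dμ` for all continuous `f`. -/
def IsEigenmeasure {Y : Type*} [TopologicalSpace Y] [CompactSpace Y] [MeasurableSpace Y]
    (R : IFSw n Y) (c : ℝ) (μ : Measure Y) : Prop :=
  ∀ f : C(Y, ℝ), ∫ x, R.transfer ℝ f x ∂μ = c * ∫ x, f x ∂μ

/-- Every map is a contraction: it has a Lipschitz constant less than one. -/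
def Contractive {Y : Type*} [MetricSpace Y] (R : IFSw n Y) : Prop :=
  ∀ j, ∃ c, ContractingWith c (R.map j)

end IFSw

/-- The modulus of continuity `t ↦ sup {|u x - u y| : d(x, y) ≤ t}`, with values in `[0, ∞]`. -/
noncomputable def oscModulus {Y : Type*} [MetricSpace Y] (u : Y → ℝ) (t : ℝ) : ENNReal :=
  ⨆ (x : Y) (y : Y) (_ : dist x y ≤ t), ENNReal.ofReal |u x - u y|

/-- The Dini condition on a positive weight `q`:
`∫_0^1 sup_{d(x, y) ≤ t} |ln q(x) - ln q(y)| / t dt < ∞`. -/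
def DiniWeight {Y : Type*} [MetricSpace Y] (q : Y → ℝ) : Prop :=
  ∫⁻ t in Set.Ioc (0 : ℝ) 1, oscModulus (fun x => Real.log (q x)) t / ENNReal.ofReal t < ⊤

/-!
The idea is that of the Ruelle–Perron–Frobenius theorem. Let `B = B_R` and
`r k x = B^k f x / B^k 1 x`. If `a ≤ r k` everywhere on a forward invariant set, then applying the
positive operator `B` to `a B^k 1 ≤ B^k f` gives `a ≤ r (k + 1)`; hence `m k = inf r k` increases to
some limit `A`.

The Dini condition says that the oscillations of `log q_j` at the scales `c^i` are summable. Hence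
along two orbits contracted by the same maps the products of the weights agree up to a constant
factor `C`, independent of the length, and so `B^l` takes nearly equal values up to this factor at
any two points. Applied to `B^k f - m k B^k 1 ≥ 0`, this gives for every `ε > 0` and all large `l`
`r l x - m k ≤ C^2 (r l y - m k + ε)` for all `x`, `y`. As the right-hand side can be made small by
choosing `k` and then `y` so that `m k` and `r l y` are near `A`, the quotients converge uniformly
to `A`. Integrating `a B^k 1 ≤ B^k f` against the eigenmeasure yields `a ≤ ∫ f dμ`, which identifies
`A` as `∫ f dμ`.

This requires compactness, which comes from working on the union of `K` and of the forward orbit of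
the given points: the latter accumulates only at `K`.
-/

open scoped Uniformity

namespace IFSw

section Transfer

variable {Y : Type*} [TopologicalSpace Y] (R : IFSw n Y)

theorem transfer_apply (f : C(Y, ℝ)) (x : Y) :
    R.transfer ℝ f x = ∑ j, R.weight j x * f (R.map j x) := by
  simp [transfer]

theorem transfer_pow_succ_apply (k : ℕ) (f : C(Y, ℝ)) (x : Y) :
    (R.transfer ℝ ^ (k + 1)) f x = ∑ j, R.weight j x * (R.transfer ℝ ^ k) f (R.map j x) := by
  rw [pow_succ', Module.End.mul_apply, transfer_apply]

theorem transfer_pow_add_apply (k l : ℕ) (f : C(Y, ℝ)) :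
    (R.transfer ℝ ^ (k + l)) f = (R.transfer ℝ ^ k) ((R.transfer ℝ ^ l) f) := by
  rw [pow_add, Module.End.mul_apply]

theorem transfer_monotone : Monotone (R.transfer ℝ) := fun f g hfg x => by
  simp only [ContinuousMap.toFun_eq_coe, transfer_apply]
  exact Finset.sum_le_sum fun j _ => mul_le_mul_of_nonneg_left (hfg _) (R.weight_pos j x).le

theorem transfer_pow_monotone (k : ℕ) : Monotone (R.transfer ℝ ^ k) := by
  rw [Module.End.coe_pow]
  exact R.transfer_monotone.iterate k

theorem transfer_pow_nonneg {f : C(Y, ℝ)} (hf : 0 ≤ f) (k : ℕ) : 0 ≤ (R.transfer ℝ ^ k) f := by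
  simpa only [map_zero] using R.transfer_pow_monotone k hf

theorem transfer_pow_one_pos [Nonempty (Fin n)] (k : ℕ) (x : Y) :
    0 < (R.transfer ℝ ^ k) 1 x := by
  induction k generalizing x with
  | zero => simp
  | succ k ih =>
    rw [transfer_pow_succ_apply]
    exact Finset.sum_pos (fun j _ => mul_pos (R.weight_pos j x) (ih _)) Finset.univ_nonempty

/-- The normalized iterate `B_R^k(f) / B_R^k(1)`. It is meaningful when there is at least one map:
otherwise `B_R = 0` and the quotient is `0 / 0` for `k ≠ 0`. -/
noncomputable def ratio (f : C(Y, ℝ)) (k : ℕ) (x : Y) : ℝ :=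
  (R.transfer ℝ ^ k) f x / (R.transfer ℝ ^ k) 1 x

theorem ratio_neg (f : C(Y, ℝ)) (k : ℕ) (x : Y) : R.ratio (-f) k x = -R.ratio f k x := by
  simp only [ratio, map_neg, ContinuousMap.neg_apply, neg_div]

section Nonempty

variable [Nonempty (Fin n)] {R} {f : C(Y, ℝ)} {a : ℝ} {k : ℕ}

theorem ratio_mul_transfer_pow_one (x : Y) :
    R.ratio f k x * (R.transfer ℝ ^ k) 1 x = (R.transfer ℝ ^ k) f x :=
  div_mul_cancel₀ _ (R.transfer_pow_one_pos k x).ne'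

theorem forall_le_ratio_iff :
    (∀ x, a ≤ R.ratio f k x) ↔ a • (R.transfer ℝ ^ k) 1 ≤ (R.transfer ℝ ^ k) f :=
  forall_congr' fun x => le_div_iff₀ (R.transfer_pow_one_pos k x)

theorem le_ratio_of_le {l : ℕ} (hkl : k ≤ l) (ha : ∀ x, a ≤ R.ratio f k x) (x : Y) :
    a ≤ R.ratio f l x := by
  obtain ⟨i, rfl⟩ := Nat.exists_eq_add_of_le' hkl
  refine forall_le_ratio_iff.2 ?_ x
  rw [transfer_pow_add_apply, transfer_pow_add_apply, ← map_smul]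
  exact R.transfer_pow_monotone i (forall_le_ratio_iff.1 ha)

theorem neg_norm_le_ratio [CompactSpace Y] (f : C(Y, ℝ)) (k : ℕ) (x : Y) :
    -‖f‖ ≤ R.ratio f k x :=
  le_ratio_of_le k.zero_le (fun y => by simpa [ratio] using f.neg_norm_le_apply y) x

theorem ratio_le_norm [CompactSpace Y] (f : C(Y, ℝ)) (k : ℕ) (x : Y) : R.ratio f k x ≤ ‖f‖ := by
  simpa only [norm_neg, ratio_neg, neg_le_neg_iff] using R.neg_norm_le_ratio (-f) k x

theorem iInf_ratio_le [CompactSpace Y] (f : C(Y, ℝ)) (k : ℕ) (x : Y) :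
    ⨅ y, R.ratio f k y ≤ R.ratio f k x :=
  ciInf_le ⟨-‖f‖, Set.forall_mem_range.2 (neg_norm_le_ratio f k)⟩ x

end Nonempty

end Transfer

section BoundedDistortion

theorem transfer_pow_le_exp_sum_mul {Y : Type*} [TopologicalSpace Y] (R : IFSw n Y)
    {E : ℕ → Y → Y → Prop} {w : ℕ → ℝ}
    (hE : ∀ i j x y, E i x y → E (i + 1) (R.map j x) (R.map j y))
    (hw : ∀ i j x y, E i x y → R.weight j x ≤ Real.exp (w i) * R.weight j y)
    {g h : C(Y, ℝ)} (hh : 0 ≤ h) {l : ℕ} (hgh : ∀ x y, E l x y → g x ≤ h y) {x y : Y}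
    (hxy : E 0 x y) :
    (R.transfer ℝ ^ l) g x ≤
      Real.exp (∑ i ∈ Finset.range l, w i) * (R.transfer ℝ ^ l) h y := by
  induction l generalizing E w x y with
  | zero => simpa using hgh x y hxy
  | succ l ih =>
    set P := Real.exp (∑ i ∈ Finset.range l, w (i + 1))
    rw [transfer_pow_succ_apply, transfer_pow_succ_apply, Finset.sum_range_succ', Real.exp_add,
      Finset.mul_sum]
    refine Finset.sum_le_sum fun j _ => ?_
    have hnonneg : 0 ≤ (R.transfer ℝ ^ l) h (R.map j y) := R.transfer_pow_nonneg hh l _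
    calc R.weight j x * (R.transfer ℝ ^ l) g (R.map j x)
        ≤ R.weight j x * (P * (R.transfer ℝ ^ l) h (R.map j y)) :=
          mul_le_mul_of_nonneg_left
            (ih (fun i => hE (i + 1)) (fun i => hw (i + 1)) hgh (hE 0 j x y hxy))
            (R.weight_pos j x).le
      _ ≤ Real.exp (w 0) * R.weight j y * (P * (R.transfer ℝ ^ l) h (R.map j y)) :=
          mul_le_mul_of_nonneg_right (hw 0 j x y hxy) (by positivity)
      _ = P * Real.exp (w 0) * (R.weight j y * (R.transfer ℝ ^ l) h (R.map j y)) := by ring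

/-- Bounded distortion with constant `C`, expressed through the transfer operator: for all large `l`
the values of `B_R^l` at two arbitrary points are comparable up to the factor `C`. Two functions are
allowed, since a common word of length `l` takes two points to nearby but not to equal points. -/
def HasBoundedDistortion {Y : Type*} [UniformSpace Y] (R : IFSw n Y) (C : ℝ) : Prop :=
  ∀ V ∈ 𝓤 Y, ∀ᶠ l in atTop, ∀ g h : C(Y, ℝ), 0 ≤ h → (∀ x y, (x, y) ∈ V → g x ≤ h y) →
    ∀ x y, (R.transfer ℝ ^ l) g x ≤ C * (R.transfer ℝ ^ l) h y

namespace HasBoundedDistortion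

variable {Y : Type*} [UniformSpace Y] {R : IFSw n Y} {C : ℝ}

theorem eventually_transfer_pow_one_le (hR : R.HasBoundedDistortion C) :
    ∀ᶠ l in atTop, ∀ x y, (R.transfer ℝ ^ l) 1 x ≤ C * (R.transfer ℝ ^ l) 1 y := by
  filter_upwards [hR Set.univ univ_mem] with l hl
  exact hl 1 1 zero_le_one fun _ _ _ => le_rfl

theorem one_le [Nonempty (Fin n)] [Nonempty Y] (hR : R.HasBoundedDistortion C) : 1 ≤ C := by
  obtain ⟨l, hl⟩ := hR.eventually_transfer_pow_one_le.exists
  obtain ⟨x⟩ := ‹Nonempty Y›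
  exact (le_mul_iff_one_le_left (R.transfer_pow_one_pos l x)).1 (hl x x)

theorem eventually_transfer_pow_le [CompactSpace Y] (hR : R.HasBoundedDistortion C)
    {g p : C(Y, ℝ)} (hg : 0 ≤ g) (hp : ∀ x, 0 < p x) :
    ∀ᶠ l in atTop, ∀ x y, (R.transfer ℝ ^ l) g x ≤ C * (R.transfer ℝ ^ l) (g + p) y := by
  have hV : {z : Y × Y | g z.1 < (g + p) z.2} ∈ 𝓤 Y := by
    rw [← nhdsSet_diagonal_eq_uniformity]
    refine (isOpen_lt (by fun_prop) (by fun_prop)).mem_nhdsSet.2 ?_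
    rintro ⟨x, y⟩ (rfl : x = y)
    exact lt_add_of_pos_right _ (hp x)
  filter_upwards [hR _ hV] with l hl
  exact hl g (g + p) (add_nonneg hg fun x => (hp x).le) fun x y hxy => le_of_lt hxy

variable [CompactSpace Y] [Nonempty (Fin n)] [Nonempty Y]

theorem eventually_ratio_sub_le (hR : R.HasBoundedDistortion C) {f : C(Y, ℝ)} {a : ℝ} {k : ℕ}
    (ha : ∀ x, a ≤ R.ratio f k x) {ε : ℝ} (hε : 0 < ε) :
    ∀ᶠ l in atTop, ∀ x y, R.ratio f l x - a ≤ C ^ 2 * (R.ratio f l y - a + ε) := by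
  have hC : 0 ≤ C := zero_le_one.trans hR.one_le
  have hnonneg : 0 ≤ (R.transfer ℝ ^ k) f - a • (R.transfer ℝ ^ k) 1 :=
    sub_nonneg.2 (forall_le_ratio_iff.1 ha)
  have hpos : ∀ x, 0 < (ε • (R.transfer ℝ ^ k) 1) x := fun x =>
    mul_pos hε (R.transfer_pow_one_pos k x)
  rw [← map_add_atTop_eq_nat k, eventually_map]
  filter_upwards [hR.eventually_transfer_pow_le hnonneg hpos,
    (tendsto_add_atTop_nat k).eventually hR.eventually_transfer_pow_one_le] with l hl hone x y
  have hcomparison := hl x y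
  simp only [map_add, map_sub, map_smul, ← transfer_pow_add_apply, ContinuousMap.add_apply,
    ContinuousMap.sub_apply, ContinuousMap.smul_apply, smul_eq_mul,
    ← ratio_mul_transfer_pow_one (f := f)] at hcomparison
  have hy : 0 ≤ R.ratio f (l + k) y - a + ε :=
    add_nonneg (sub_nonneg.2 (le_ratio_of_le (Nat.le_add_left k l) ha y)) hε.le
  refine le_of_mul_le_mul_right ?_ (R.transfer_pow_one_pos (l + k) x)
  calc (R.ratio f (l + k) x - a) * (R.transfer ℝ ^ (l + k)) 1 x
      ≤ C * (R.ratio f (l + k) y - a + ε) * (R.transfer ℝ ^ (l + k)) 1 y := by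
        linarith
    _ ≤ C * (R.ratio f (l + k) y - a + ε) * (C * (R.transfer ℝ ^ (l + k)) 1 x) :=
        mul_le_mul_of_nonneg_left (hone y x) (mul_nonneg hC hy)
    _ = C ^ 2 * (R.ratio f (l + k) y - a + ε) * (R.transfer ℝ ^ (l + k)) 1 x := by ring

theorem exists_tendstoUniformly_ratio (hR : R.HasBoundedDistortion C) (f : C(Y, ℝ)) :
    ∃ A : ℝ, TendstoUniformly (R.ratio f) (fun _ => A) atTop := by
  set m : ℕ → ℝ := fun k => ⨅ x, R.ratio f k x
  have hm_bdd : BddAbove (Set.range m) := ⟨‖f‖, Set.forall_mem_range.2 fun k =>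
    (iInf_ratio_le f k (Classical.arbitrary Y)).trans (ratio_le_norm f k _)⟩
  refine ⟨⨆ k, m k, Metric.tendstoUniformly_iff.2 fun ε hε => ?_⟩
  set A := ⨆ k, m k
  have hC : 1 ≤ C ^ 2 := one_le_pow₀ hR.one_le
  have hC0 : C ≠ 0 := (zero_lt_one.trans_le hR.one_le).ne'
  obtain ⟨δ, hδ, hCδ⟩ : ∃ δ > 0, C ^ 2 * (3 * δ) = ε :=
    ⟨ε / (3 * C ^ 2), by positivity, by field_simp⟩
  have hδε : δ < ε := by nlinarith
  obtain ⟨k, hk⟩ : ∃ k, A - δ < m k := exists_lt_of_lt_ciSup (sub_lt_self A hδ)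
  filter_upwards [hR.eventually_ratio_sub_le (iInf_ratio_le f k) hδ, eventually_ge_atTop k]
    with l hl hkl x
  obtain ⟨y, hy⟩ : ∃ y, R.ratio f l y < A + δ :=
    exists_lt_of_ciInf_lt ((le_ciSup hm_bdd l).trans_lt (lt_add_of_pos_right A hδ))
  have hlower : m k ≤ R.ratio f l x := le_ratio_of_le hkl (iInf_ratio_le f k) x
  have hupper : R.ratio f l x < A + ε := calc
    R.ratio f l x ≤ m k + C ^ 2 * (R.ratio f l y - m k + δ) := by linarith [hl x y]
    _ < A + C ^ 2 * (3 * δ) :=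
      add_lt_add_of_le_of_lt (le_ciSup hm_bdd k) (by gcongr; linarith)
    _ = A + ε := by rw [hCδ]
  rw [dist_comm, Real.dist_eq, abs_lt]
  constructor <;> linarith

end HasBoundedDistortion

end BoundedDistortion

section Eigenmeasure

variable {Y : Type*} [TopologicalSpace Y] [CompactSpace Y] [MeasurableSpace Y] {R : IFSw n Y}
  {c : ℝ} {μ : Measure Y}

theorem IsEigenmeasure.integral_transfer_pow (hμ : R.IsEigenmeasure c μ) (k : ℕ) (f : C(Y, ℝ)) :
    ∫ x, (R.transfer ℝ ^ k) f x ∂μ = c ^ k * ∫ x, f x ∂μ := by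
  induction k with
  | zero => simp
  | succ k ih => rw [pow_succ', Module.End.mul_apply, hμ, ih, pow_succ', mul_assoc]

variable [OpensMeasurableSpace Y]

theorem integrable_continuousMap (μ : Measure Y) [IsFiniteMeasure μ] (f : C(Y, ℝ)) :
    Integrable f μ :=
  f.continuous.integrable_of_hasCompactSupport (.of_compactSpace f)

variable [Nonempty (Fin n)] [IsProbabilityMeasure μ]

theorem IsEigenmeasure.pos (hμ : R.IsEigenmeasure c μ) : 0 < c := by
  have hpos : ∀ x, 0 < R.transfer ℝ 1 x := by simpa using R.transfer_pow_one_pos 1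
  calc 0 < ∫ x, R.transfer ℝ 1 x ∂μ := by
        rw [integral_pos_iff_support_of_nonneg (fun x => (hpos x).le)
          (integrable_continuousMap μ _), Function.support_eq_univ fun x => (hpos x).ne',
          measure_univ]
        exact one_pos
    _ = c := by simpa using hμ 1

theorem IsEigenmeasure.le_integral_of_le_ratio (hμ : R.IsEigenmeasure c μ) {f : C(Y, ℝ)} {a : ℝ}
    {k : ℕ} (ha : ∀ x, a ≤ R.ratio f k x) : a ≤ ∫ x, f x ∂μ := by
  have hle : ∫ x, (a • (R.transfer ℝ ^ k) 1) x ∂μ ≤ ∫ x, (R.transfer ℝ ^ k) f x ∂μ :=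
    integral_mono (integrable_continuousMap μ _) (integrable_continuousMap μ _)
      (forall_le_ratio_iff.1 ha)
  rw [← map_smul, hμ.integral_transfer_pow, hμ.integral_transfer_pow] at hle
  simpa using le_of_mul_le_mul_left hle (pow_pos hμ.pos k)

theorem IsEigenmeasure.integral_le_of_ratio_le (hμ : R.IsEigenmeasure c μ) {f : C(Y, ℝ)} {a : ℝ}
    {k : ℕ} (ha : ∀ x, R.ratio f k x ≤ a) : ∫ x, f x ∂μ ≤ a := by
  have hneg := hμ.le_integral_of_le_ratio (f := -f) (a := -a) (k := k) fun x => by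
    simpa only [ratio_neg, neg_le_neg_iff] using ha x
  simpa only [ContinuousMap.neg_apply, integral_neg, neg_le_neg_iff] using hneg

theorem IsEigenmeasure.eq_integral_of_tendstoUniformly_ratio (hμ : R.IsEigenmeasure c μ)
    {f : C(Y, ℝ)} {A : ℝ} (hA : TendstoUniformly (R.ratio f) (fun _ => A) atTop) :
    A = ∫ x, f x ∂μ := by
  refine eq_of_forall_dist_le fun ε hε => ?_
  obtain ⟨k, hk⟩ := (Metric.tendstoUniformly_iff.1 hA ε hε).exists
  have hratio : ∀ x, A - ε ≤ R.ratio f k x ∧ R.ratio f k x ≤ A + ε := fun x => by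
    have := abs_lt.1 (hk x)
    constructor <;> linarith
  have hlower := hμ.le_integral_of_le_ratio fun x => (hratio x).1
  have hupper := hμ.integral_le_of_ratio_le fun x => (hratio x).2
  rw [Real.dist_eq, abs_le]
  constructor <;> linarith

end Eigenmeasure

end IFSw

section Dini

variable {Y : Type*} [MetricSpace Y]

theorem oscModulus_mono (u : Y → ℝ) : Monotone (oscModulus u) := fun _ _ hst =>
  iSup₂_mono fun _ _ => iSup_mono' fun h => ⟨h.trans hst, le_rfl⟩

theorem ofReal_abs_sub_le_oscModulus (u : Y → ℝ) {x y : Y} {t : ℝ} (h : dist x y ≤ t) :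
    ENNReal.ofReal |u x - u y| ≤ oscModulus u t :=
  le_iSup₂_of_le x y (le_iSup_of_le h le_rfl)

theorem oscModulus_comp_le {Z : Type*} [MetricSpace Z] {φ : Z → Y} (hφ : Isometry φ) (u : Y → ℝ)
    (t : ℝ) : oscModulus (u ∘ φ) t ≤ oscModulus u t :=
  iSup₂_le fun x y => iSup_le fun h =>
    ofReal_abs_sub_le_oscModulus u (by rwa [hφ.dist_eq])

theorem oscModulus_ne_top [CompactSpace Y] {u : Y → ℝ} (hu : Continuous u) (t : ℝ) :
    oscModulus u t ≠ ⊤ := by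
  have hle : oscModulus u t ≤ ENNReal.ofReal (Metric.diam (Set.range u)) :=
    iSup₂_le fun x y => iSup_le fun _ => ENNReal.ofReal_le_ofReal <|
      Metric.dist_le_diam_of_mem (isCompact_range hu).isBounded ⟨x, rfl⟩ ⟨y, rfl⟩
  exact ne_top_of_le_ne_top ENNReal.ofReal_ne_top hle

theorem abs_sub_le_toReal_oscModulus [CompactSpace Y] {u : Y → ℝ} (hu : Continuous u) {x y : Y}
    {t : ℝ} (h : dist x y ≤ t) : |u x - u y| ≤ (oscModulus u t).toReal :=
  (ENNReal.ofReal_le_iff_le_toReal (oscModulus_ne_top hu t)).1 (ofReal_abs_sub_le_oscModulus u h)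

theorem DiniWeight.comp_isometry {Z : Type*} [MetricSpace Z] {q : Y → ℝ} (hq : DiniWeight q)
    {φ : Z → Y} (hφ : Isometry φ) : DiniWeight (q ∘ φ) :=
  (lintegral_mono fun t => ENNReal.div_le_div_right
    (oscModulus_comp_le hφ (fun x => Real.log (q x)) t) _).trans_lt hq

theorem ofReal_mul_oscModulus_le_lintegral (u : Y → ℝ) {s t : ℝ} (ht : 0 < t) :
    ENNReal.ofReal ((t - s) / t) * oscModulus u s ≤
      ∫⁻ r in Set.Ioc s t, oscModulus u r / ENNReal.ofReal r := by
  calc ENNReal.ofReal ((t - s) / t) * oscModulus u s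
      = ∫⁻ _ in Set.Ioc s t, oscModulus u s / ENNReal.ofReal t := by
        rw [setLIntegral_const, Real.volume_Ioc, ENNReal.ofReal_div_of_pos ht, mul_comm,
          ← mul_div_assoc, ENNReal.mul_div_right_comm]
    _ ≤ ∫⁻ r in Set.Ioc s t, oscModulus u r / ENNReal.ofReal r :=
        setLIntegral_mono' measurableSet_Ioc fun r hr =>
          ENNReal.div_le_div (oscModulus_mono u hr.1.le) (ENNReal.ofReal_le_ofReal hr.2)

theorem DiniWeight.tsum_oscModulus_ne_top {q : Y → ℝ} (hq : DiniWeight q) {c : ℝ} (hc : 0 < c)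
    (hc1 : c < 1) : ∑' i : ℕ, oscModulus (fun x => Real.log (q x)) (c ^ (i + 1)) ≠ ⊤ := by
  set Ω := oscModulus fun x => Real.log (q x)
  have hanti : Antitone fun i : ℕ => c ^ i := fun i j hij => pow_le_pow_of_le_one hc.le hc1.le hij
  have hdisj : Pairwise (Function.onFun Disjoint fun i : ℕ => Set.Ioc (c ^ (i + 1)) (c ^ i)) := by
    simpa only [Nat.succ_eq_succ, Nat.succ_eq_add_one] using hanti.pairwise_disjoint_on_Ioc_succ
  have hpiece : ∀ i : ℕ, ENNReal.ofReal (1 - c) * Ω (c ^ (i + 1)) ≤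
      ∫⁻ t in Set.Ioc (c ^ (i + 1)) (c ^ i), Ω t / ENNReal.ofReal t := fun i => by
    have hrel : (c ^ i - c ^ (i + 1)) / c ^ i = 1 - c := by
      rw [div_eq_iff (pow_pos hc i).ne']
      ring
    simpa only [hrel] using ofReal_mul_oscModulus_le_lintegral (fun x => Real.log (q x))
      (s := c ^ (i + 1)) (pow_pos hc i)
  have hle : ENNReal.ofReal (1 - c) * ∑' i : ℕ, Ω (c ^ (i + 1)) < ⊤ := calc
    ENNReal.ofReal (1 - c) * ∑' i : ℕ, Ω (c ^ (i + 1))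
        ≤ ∑' i : ℕ, ∫⁻ t in Set.Ioc (c ^ (i + 1)) (c ^ i), Ω t / ENNReal.ofReal t := by
          rw [← ENNReal.tsum_mul_left]
          exact ENNReal.tsum_le_tsum hpiece
      _ = ∫⁻ t in ⋃ i : ℕ, Set.Ioc (c ^ (i + 1)) (c ^ i), Ω t / ENNReal.ofReal t :=
          (lintegral_iUnion (fun _ => measurableSet_Ioc) hdisj _).symm
      _ ≤ ∫⁻ t in Set.Ioc (0 : ℝ) 1, Ω t / ENNReal.ofReal t :=
          lintegral_mono_set (Set.iUnion_subset fun i =>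
            Set.Ioc_subset_Ioc (pow_pos hc _).le (pow_le_one₀ hc.le hc1.le))
      _ < ⊤ := hq
  intro htop
  rw [htop, ENNReal.mul_top (by simpa using hc1)] at hle
  exact hle.ne rfl

theorem DiniWeight.summable_oscModulus [CompactSpace Y] {q : C(Y, ℝ)} (hq : DiniWeight q)
    (hq0 : ∀ x, q x ≠ 0) {c : ℝ} (hc : 0 < c) (hc1 : c < 1) (D : ℝ) :
    Summable fun i : ℕ => (oscModulus (fun x => Real.log (q x)) (c ^ i * D)).toReal := by
  have hlog : Continuous fun x => Real.log (q x) := q.continuous.log hq0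
  obtain ⟨N, hN⟩ : ∃ N : ℕ, c ^ N * D < c := by
    have hlim : Tendsto (fun N : ℕ => c ^ N * D) atTop (𝓝 0) := by
      simpa using (tendsto_pow_atTop_nhds_zero_of_lt_one hc.le hc1).mul_const D
    exact (hlim.eventually (gt_mem_nhds hc)).exists
  refine (summable_nat_add_iff N).1 <| .of_nonneg_of_le (fun _ => ENNReal.toReal_nonneg)
    (fun i => ENNReal.toReal_mono (oscModulus_ne_top hlog _) (oscModulus_mono _ ?_))
    (ENNReal.summable_toReal (hq.tsum_oscModulus_ne_top hc hc1))
  calc c ^ (i + N) * D = c ^ i * (c ^ N * D) := by ring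
    _ ≤ c ^ i * c := by gcongr
    _ = c ^ (i + 1) := (pow_succ c i).symm

end Dini

namespace IFSw

section Contractive

variable {Y : Type*} [MetricSpace Y] {R : IFSw n Y}

theorem Contractive.exists_lipschitzWith (hτ : R.Contractive) :
    ∃ c : NNReal, 0 < c ∧ c < 1 ∧ ∀ j, LipschitzWith c (R.map j) := by
  choose c hc using hτ
  refine ⟨max (1 / 2) (Finset.univ.sup c), lt_max_of_lt_left (by norm_num),
    max_lt (by norm_num) ((Finset.sup_lt_iff (by simp)).2 fun j _ => (hc j).1), fun j =>
    (hc j).2.weaken (le_max_of_le_right (Finset.le_sup (Finset.mem_univ j)))⟩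

theorem weight_le_exp_mul_weight [CompactSpace Y] (R : IFSw n Y) (j : Fin n) {x y : Y} {t : ℝ}
    (h : dist x y ≤ t) :
    R.weight j x ≤
      Real.exp (∑ i, (oscModulus (fun x => Real.log (R.weight i x)) t).toReal) * R.weight j y := by
  have hosc := abs_sub_le_toReal_oscModulus
    ((R.weight j).continuous.log fun x => (R.weight_pos j x).ne') h
  have hsum := Finset.single_le_sum
    (f := fun i => (oscModulus (fun x => Real.log (R.weight i x)) t).toReal)
    (fun _ _ => ENNReal.toReal_nonneg) (Finset.mem_univ j)
  rw [← Real.log_le_log_iff (R.weight_pos j x) (mul_pos (Real.exp_pos _) (R.weight_pos j y)),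
    Real.log_mul (Real.exp_ne_zero _) (R.weight_pos j y).ne', Real.log_exp]
  linarith [le_abs_self (Real.log (R.weight j x) - Real.log (R.weight j y))]

theorem Contractive.exists_hasBoundedDistortion [CompactSpace Y] (hτ : R.Contractive)
    (hq : ∀ j, DiniWeight (R.weight j)) : ∃ C, R.HasBoundedDistortion C := by
  obtain ⟨c, hc, hc1, hcτ⟩ := hτ.exists_lipschitzWith
  set D := Metric.diam (Set.univ : Set Y)
  set w : ℕ → ℝ := fun i =>
    ∑ j, (oscModulus (fun x => Real.log (R.weight j x)) (c ^ i * D)).toReal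
  have hw : Summable w := summable_sum fun j _ =>
    (hq j).summable_oscModulus (fun x => (R.weight_pos j x).ne') (NNReal.coe_pos.2 hc) hc1 D
  refine ⟨Real.exp (∑' i, w i), fun V hV => ?_⟩
  obtain ⟨δ, hδ, hδV⟩ := Metric.mem_uniformity_dist.1 hV
  have hlim : Tendsto (fun l : ℕ => (c : ℝ) ^ l * D) atTop (𝓝 0) := by
    simpa using (tendsto_pow_atTop_nhds_zero_of_lt_one c.2 hc1).mul_const D
  filter_upwards [hlim.eventually (gt_mem_nhds hδ)] with l hl g h hh hgh x y
  have hcontract : ∀ i j x y, dist x y ≤ c ^ i * D →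
      dist (R.map j x) (R.map j y) ≤ c ^ (i + 1) * D := fun i j x y hxy => calc
    dist (R.map j x) (R.map j y) ≤ c * dist x y := (hcτ j).dist_le_mul x y
    _ ≤ c * (c ^ i * D) := by gcongr
    _ = c ^ (i + 1) * D := by ring
  calc (R.transfer ℝ ^ l) g x
      ≤ Real.exp (∑ i ∈ Finset.range l, w i) * (R.transfer ℝ ^ l) h y :=
        R.transfer_pow_le_exp_sum_mul (E := fun i x y => dist x y ≤ c ^ i * D) hcontract
          (fun i j x y => R.weight_le_exp_mul_weight j) hh
          (fun u v huv => hgh u v (hδV (huv.trans_lt hl)))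
          (by simpa using Metric.dist_le_diam_of_mem isCompact_univ.isBounded trivial trivial)
    _ ≤ Real.exp (∑' i, w i) * (R.transfer ℝ ^ l) h y :=
        mul_le_mul_of_nonneg_right (Real.exp_le_exp.2 <| hw.sum_le_tsum _ fun _ _ =>
          Finset.sum_nonneg fun _ _ => ENNReal.toReal_nonneg) (R.transfer_pow_nonneg hh l y)

theorem IsEigenmeasure.tendstoUniformly_ratio [CompactSpace Y] [Nonempty (Fin n)]
    [MeasurableSpace Y] [OpensMeasurableSpace Y] {ρ : ℝ} {μ : Measure Y} [IsProbabilityMeasure μ]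
    (hμ : R.IsEigenmeasure ρ μ) (hτ : R.Contractive) (hq : ∀ j, DiniWeight (R.weight j))
    (f : C(Y, ℝ)) : TendstoUniformly (R.ratio f) (fun _ => ∫ x, f x ∂μ) atTop := by
  have : Nonempty Y := nonempty_of_isProbabilityMeasure μ
  obtain ⟨C, hC⟩ := hτ.exists_hasBoundedDistortion hq
  obtain ⟨A, hA⟩ := hC.exists_tendstoUniformly_ratio f
  rwa [← hμ.eq_integral_of_tendstoUniformly_ratio hA]

end Contractive

section Semiconj

variable {Y Z : Type*} [TopologicalSpace Y] [TopologicalSpace Z]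

/-- The continuous map `φ` intertwines the maps of `S` and `R`, and pulls the weights of `R` back to
those of `S`. The inclusions between forward invariant sets are of this kind. -/
structure Semiconj (φ : C(Z, Y)) (S : IFSw n Z) (R : IFSw n Y) : Prop where
  map_eq : ∀ j z, φ (S.map j z) = R.map j (φ z)
  weight_eq : ∀ j z, S.weight j z = R.weight j (φ z)

variable {φ : C(Z, Y)} {S : IFSw n Z} {R : IFSw n Y}

theorem Semiconj.transfer_pow_comp (h : Semiconj φ S R) (f : C(Y, ℝ)) (k : ℕ) :
    (S.transfer ℝ ^ k) (f.comp φ) = ((R.transfer ℝ ^ k) f).comp φ := by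
  induction k with
  | zero => rfl
  | succ k ih =>
    ext z
    rw [transfer_pow_succ_apply, ih, ContinuousMap.comp_apply, transfer_pow_succ_apply]
    simp only [ContinuousMap.comp_apply, h.map_eq, h.weight_eq]

theorem Semiconj.ratio_comp (h : Semiconj φ S R) (f : C(Y, ℝ)) (k : ℕ) (z : Z) :
    S.ratio (f.comp φ) k z = R.ratio f k (φ z) := by
  simp only [ratio, ← ContinuousMap.one_comp φ, h.transfer_pow_comp, ContinuousMap.comp_apply]

theorem IsEigenmeasure.map [CompactSpace Y] [MeasurableSpace Y] [OpensMeasurableSpace Y]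
    [CompactSpace Z] [MeasurableSpace Z] {c : ℝ} {μ : Measure Z} (hμ : S.IsEigenmeasure c μ)
    (h : Semiconj φ S R) (hφ : Measurable φ) : R.IsEigenmeasure c (μ.map φ) := fun f => by
  have hmap : ∀ g : C(Y, ℝ), ∫ y, g y ∂(μ.map φ) = ∫ z, g.comp φ z ∂μ := fun g =>
    integral_map hφ.aemeasurable g.continuous.aestronglyMeasurable
  have hcomp := h.transfer_pow_comp f 1
  simp only [pow_one] at hcomp
  rw [hmap, hmap, ← hcomp, hμ]

end Semiconj

section Restrict

/-- The restriction of an IFSw to a forward invariant set. -/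
def restrict {Y : Type*} [TopologicalSpace Y] (R : IFSw n Y) {X : Set Y}
    (hX : ∀ j, Set.MapsTo (R.map j) X X) : IFSw n X where
  map j := ⟨(hX j).restrict, (R.map j).continuous.restrict (hX j)⟩
  weight j := (R.weight j).restrict X
  weight_pos j x := R.weight_pos j x

theorem semiconj_val_restrict {Y : Type*} [TopologicalSpace Y] (R : IFSw n Y) {X : Set Y}
    (hX : ∀ j, Set.MapsTo (R.map j) X X) :
    Semiconj ⟨Subtype.val, continuous_subtype_val⟩ (R.restrict hX) R :=
  ⟨fun _ _ => rfl, fun _ _ => rfl⟩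

theorem semiconj_inclusion_restrict {Y : Type*} [TopologicalSpace Y] (R : IFSw n Y) {K X : Set Y}
    (hK : ∀ j, Set.MapsTo (R.map j) K K) (hX : ∀ j, Set.MapsTo (R.map j) X X) (hKX : K ⊆ X) :
    Semiconj ⟨Set.inclusion hKX, continuous_inclusion hKX⟩ (R.restrict hK) (R.restrict hX) :=
  ⟨fun _ _ => rfl, fun _ _ => rfl⟩

theorem Contractive.restrict {Y : Type*} [MetricSpace Y] {R : IFSw n Y} (hτ : R.Contractive)
    {X : Set Y} (hX : ∀ j, Set.MapsTo (R.map j) X X) : (R.restrict hX).Contractive := fun j =>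
  let ⟨c, hc⟩ := hτ j
  ⟨c, hc.restrict (hX j)⟩

end Restrict

end IFSw

theorem isCompact_union_iUnion_of_eventually_subset {X ι : Type*} [TopologicalSpace X] {K : Set X}
    {F : ι → Set X} (hK : IsCompact K) (hF : ∀ i, IsCompact (F i))
    (hFK : ∀ U ∈ 𝓝ˢ K, ∀ᶠ i in cofinite, F i ⊆ U) : IsCompact (K ∪ ⋃ i, F i) := by
  classical
  refine isCompact_of_finite_subcover fun U hU hcover => ?_
  obtain ⟨t, ht⟩ := hK.elim_finite_subcover U hU (Set.subset_union_left.trans hcover)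
  have hfar : {i | ¬F i ⊆ ⋃ j ∈ t, U j}.Finite :=
    hFK _ ((isOpen_biUnion fun j _ => hU j).mem_nhdsSet.2 ht)
  obtain ⟨s, hs⟩ := (hfar.isCompact_biUnion fun i _ => hF i).elim_finite_subcover U hU
    ((Set.iUnion₂_subset fun i _ => Set.subset_iUnion F i).trans
      (Set.subset_union_right.trans hcover))
  refine ⟨t ∪ s, ?_⟩
  rw [Finset.set_biUnion_union]
  refine Set.union_subset (ht.trans Set.subset_union_left) (Set.iUnion_subset fun i => ?_)
  by_cases hi : F i ⊆ ⋃ j ∈ t, U j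
  · exact hi.trans Set.subset_union_left
  · exact (Set.subset_biUnion_of_mem (u := F) hi).trans (hs.trans Set.subset_union_right)

namespace IFSw

section Hutchinson

/-- The Hutchinson operator `A ↦ ⋃ j, τ_j(A)` on subsets. -/
def hutchinson {Y : Type*} [TopologicalSpace Y] (R : IFSw n Y) (A : Set Y) : Set Y :=
  ⋃ j, R.map j '' A

variable {Y : Type*} [MetricSpace Y] (R : IFSw n Y) {A K : Set Y}

theorem isCompact_iterate_hutchinson (hA : IsCompact A) (k : ℕ) :
    IsCompact (R.hutchinson^[k] A) := by
  induction k with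
  | zero => exact hA
  | succ k ih =>
    rw [Function.iterate_succ_apply']
    exact isCompact_iUnion fun j => ih.image (R.map j).continuous

theorem iterate_hutchinson_subset_thickening (hK : ∀ j, Set.MapsTo (R.map j) K K) {c : NNReal}
    (hc : 0 < c) (hτ : ∀ j, LipschitzWith c (R.map j)) {r : ℝ} (hA : A ⊆ Metric.thickening r K)
    (k : ℕ) : R.hutchinson^[k] A ⊆ Metric.thickening (c ^ k * r) K := by
  induction k with
  | zero => simpa using hA
  | succ k ih =>
    rw [Function.iterate_succ_apply']
    refine Set.iUnion_subset fun j => Set.image_subset_iff.2 fun z hz => ?_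
    obtain ⟨y, hy, hzy⟩ := Metric.mem_thickening_iff.1 (ih hz)
    refine Metric.mem_thickening_iff.2 ⟨R.map j y, hK j hy, ?_⟩
    calc dist (R.map j z) (R.map j y) ≤ c * dist z y := (hτ j).dist_le_mul z y
      _ < c * (c ^ k * r) := by gcongr
      _ = c ^ (k + 1) * r := by ring

variable {R}

theorem Contractive.eventually_iterate_hutchinson_subset (hτ : R.Contractive) (hK : IsCompact K)
    (hK0 : K.Nonempty) (hKR : ∀ j, Set.MapsTo (R.map j) K K) (hA : Bornology.IsBounded A)
    {U : Set Y} (hU : U ∈ 𝓝ˢ K) : ∀ᶠ k in atTop, R.hutchinson^[k] A ⊆ U := by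
  obtain ⟨c, hc, hc1, hcτ⟩ := hτ.exists_lipschitzWith
  obtain ⟨y, hy⟩ := hK0
  obtain ⟨r, hr⟩ := hA.subset_ball y
  obtain ⟨V, hV, hKV, hVU⟩ := mem_nhdsSet_iff_exists.1 hU
  obtain ⟨δ, hδ, hδV⟩ := hK.exists_thickening_subset_open hV hKV
  have hlim : Tendsto (fun k : ℕ => (c : ℝ) ^ k * r) atTop (𝓝 0) := by
    simpa using (tendsto_pow_atTop_nhds_zero_of_lt_one c.2 hc1).mul_const r
  filter_upwards [hlim.eventually (gt_mem_nhds hδ)] with k hk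
  calc R.hutchinson^[k] A ⊆ Metric.thickening (c ^ k * r) K :=
        R.iterate_hutchinson_subset_thickening hKR hc hcτ
          (hr.trans (Metric.ball_subset_thickening hy r)) k
    _ ⊆ Metric.thickening δ K := Metric.thickening_mono hk.le K
    _ ⊆ U := hδV.trans hVU

theorem Contractive.exists_isCompact_mapsTo_superset (hτ : R.Contractive) (hK : IsCompact K)
    (hK0 : K.Nonempty) (hKR : ∀ j, Set.MapsTo (R.map j) K K) (hA : IsCompact A) :
    ∃ X, IsCompact X ∧ (∀ j, Set.MapsTo (R.map j) X X) ∧ K ⊆ X ∧ A ⊆ X := by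
  refine ⟨K ∪ ⋃ k, R.hutchinson^[k] A, ?_, fun j => ?_, Set.subset_union_left,
    (Set.subset_iUnion (fun k => R.hutchinson^[k] A) 0).trans Set.subset_union_right⟩
  · refine isCompact_union_iUnion_of_eventually_subset hK (R.isCompact_iterate_hutchinson hA)
      fun U hU => ?_
    rw [Nat.cofinite_eq_atTop]
    exact hτ.eventually_iterate_hutchinson_subset hK hK0 hKR hA.isBounded hU
  · refine (hKR j).union_union fun z hz => ?_
    obtain ⟨k, hk⟩ := Set.mem_iUnion.1 hz
    refine Set.mem_iUnion.2 ⟨k + 1, ?_⟩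
    rw [Function.iterate_succ_apply']
    exact Set.mem_iUnion.2 ⟨j, z, hk, rfl⟩

end Hutchinson

theorem IsAttractor.nonempty_index {Y : Type*} [TopologicalSpace Y] {R : IFSw n Y}
    {K : TopologicalSpace.NonemptyCompacts Y} (hK : R.IsAttractor K) : Nonempty (Fin n) := by
  obtain ⟨x, hx⟩ := K.nonempty
  rw [← hK] at hx
  exact ⟨(Set.mem_iUnion.1 hx).choose⟩

end IFSw

theorem mainTheorem7_general {n : ℕ} [Nonempty (Fin n)] {Y : Type*} [MetricSpace Y]
    [MeasurableSpace Y] [OpensMeasurableSpace Y] (R : IFSw n Y) (hτ : R.Contractive)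
    (hq : ∀ j, DiniWeight (R.weight j)) {K : Set Y} [CompactSpace K]
    (hK : ∀ j, Set.MapsTo (R.map j) K K) {ρ : ℝ} {μ : Measure K} [IsProbabilityMeasure μ]
    (hμ : (R.restrict hK).IsEigenmeasure ρ μ) (f : C(Y, ℝ)) {A : Set Y} (hA : IsCompact A) :
    TendstoUniformlyOn
      (fun (k : ℕ) x => ((R.transfer ℝ)^[k] f) x / ((R.transfer ℝ)^[k] 1) x)
      (fun _ => ∫ x : K, f x ∂μ) atTop A := by
  have hK0 : K.Nonempty := Set.nonempty_coe_sort.1 (nonempty_of_isProbabilityMeasure μ)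
  obtain ⟨X, hXc, hX, hKX, hAX⟩ :=
    hτ.exists_isCompact_mapsTo_superset (isCompact_iff_compactSpace.2 ‹_›) hK0 hK hA
  have : CompactSpace X := isCompact_iff_compactSpace.1 hXc
  have hι : Measurable (Set.inclusion hKX) := measurable_inclusion hKX
  have : IsProbabilityMeasure (μ.map (Set.inclusion hKX)) :=
    Measure.isProbabilityMeasure_map hι.aemeasurable
  have hint : ∫ x, f.restrict X x ∂(μ.map (Set.inclusion hKX)) = ∫ x : K, f x ∂μ :=
    integral_map hι.aemeasurable (f.restrict X).continuous.aestronglyMeasurable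
  have hunif : TendstoUniformly ((R.restrict hX).ratio (f.restrict X))
      (fun _ => ∫ x, f.restrict X x ∂(μ.map (Set.inclusion hKX))) atTop :=
    (hμ.map (R.semiconj_inclusion_restrict hK hX hKX) hι).tendstoUniformly_ratio
      (hτ.restrict hX) (fun j => (hq j).comp_isometry isometry_subtype_coe) (f.restrict X)
  rw [hint] at hunif
  have hratio : ∀ k (x : X), (R.restrict hX).ratio (f.restrict X) k x = R.ratio f k x :=
    (R.semiconj_val_restrict hX).ratio_comp f
  refine Metric.tendstoUniformlyOn_iff.2 fun ε hε => ?_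
  filter_upwards [Metric.tendstoUniformly_iff.1 hunif ε hε] with k hk x hx
  have hdist : dist (∫ x : K, f x ∂μ) (R.ratio f k x) < ε := hratio k ⟨x, hAX hx⟩ ▸ hk ⟨x, hAX hx⟩
  simpa only [IFSw.ratio, Module.End.pow_apply] using hdist

theorem mainTheorem7 {n : ℕ} {Y : Type*} [MetricSpace Y] [MeasurableSpace Y] [BorelSpace Y]
    (R : IFSw n Y) (hτ : R.Contractive) (hq : ∀ j, DiniWeight (R.weight j))
    (K : TopologicalSpace.NonemptyCompacts Y) (hK : R.IsAttractor K)
    (μ : Measure K) [IsProbabilityMeasure μ]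
    (hμ : (R.onAttractor hK).IsEigenmeasure (R.onAttractor hK).specRadius μ)
    (x₀ : Y) (f : C(Y, ℝ)) :
    Tendsto (fun k : ℕ => ((R.transfer ℝ)^[k] f) x₀ / ((R.transfer ℝ)^[k] 1) x₀) atTop
      (𝓝 (∫ x : K, f x ∂μ)) := by
  have : Nonempty (Fin n) := hK.nonempty_index
  have : CompactSpace (K : Set Y) := isCompact_iff_compactSpace.1 K.isCompact
  exact (mainTheorem7_general R hτ hq (K := (K : Set Y)) hK.mapsTo hμ f
    isCompact_singleton).tendsto_at (Set.mem_singleton x₀)
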